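/- **Theorem 1.1.** Let $D$ be a connected link diagram in the plane with at least one crossing. Assume that $D$ is reduced (no crossing meets a region of $D$ more than once) and checkerboard-colored (every region is shaded black or white so that, around each crossing, two opposite regions are black and the other two are white). Let $G$ be the associated Tait graph: the multigraph whose vertices are the black regions and which has one edge for each crossing $c$, joining the two black regions that meet opposite each other at $c$. The edge is labeled $+$ if the A-resolution of $c$ merges these two black regions at $c$, and $-$ if the B-resolution does. (The A-resolution merges the two regions at $c$ that are swept out when the over-strand is rotated counterclockwise to the under-strand; the B-resolution merges the other two.) Let $\sigma$ be a state of $D$, that is, a choice of the A- or the B-resolution at each crossing. Call $D$ *$\sigma$-adequate* if, after resolving all crossings according to $\sigma$, there is no crossing whose two resulting arcs (the arcs connected by its state segment) lie on the same state circle. Let $E_\sigma \subseteq E(G)$ be the set of all $+$ edges whose crossings are A-resolved and all $-$ edges whose crossings are B-resolved, let $\overline{E_\sigma} = E(G) \setminus E_\sigma$, and let $G|E_\sigma$ be the spanning subgraph of $G$ (same vertices as $G$) with edge set $E_\sigma$. Then $D$ is $\sigma$-adequate if and only if the following two conditions hold: 1. every edge of $E_\sigma$ is contained in a cycle of $G|E_\sigma$;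 2. no edge of $\overline{E_\sigma}$ has both endpoints in the same connected component of $G|E_\sigma$. -/

import Mathlib

/-! # Link diagrams, checkerboard colorings, Tait graphs and states

A link diagram with at least one crossing is encoded by the combinatorial map (rotation system) of
its projection graph, together with the crossing information.  At every crossing `c` the four
half-edges ("arms") `(c, 0), (c, 1), (c, 2), (c, 3)` are listed in counterclockwise order; the arms
`0` and `2` form the under-strand and the arms `1` and `3` form the over-strand (this is the
convention of planar diagram codes).  The edges of the projection graph pair up the arms. -/

/-- The underlying gluing data of a link diagram with crossing set `C`: a fixed-point-free
involution on the arms, exchanging the two ends of every edge of the projection graph. -/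
structure LinkShadow (C : Type*) where
  /-- the other end of the edge that leaves along a given arm -/
  edge : Equiv.Perm (C × Fin 4)
  edge_edge : ∀ a, edge (edge a) = a
  edge_ne : ∀ a, edge a ≠ a

namespace LinkShadow

variable {C : Type*}

/-- Rotation by one arm counterclockwise about each crossing. -/
def turn (C : Type*) : Equiv.Perm (C × Fin 4) :=
  (Equiv.refl C).prodCongr (Equiv.addRight (1 : Fin 4))

/-- The *corner* `(c, i)` is the sector at the crossing `c` between the arm `i` and the arm `i + 1`.
Leaving `c` along the arm `i`, this corner is on the left.  Following the edge to its other end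
`(c', j)`, the corner on the left upon arrival is `(c', j - 1)`; this permutation of the corners
walks around the boundary of a complementary region. -/
def nextCorner (D : LinkShadow C) : Equiv.Perm (C × Fin 4) :=
  (turn C)⁻¹ * D.edge

/-- The regions: cycles of corners.  (For a connected diagram these are exactly the complementary
regions of the projection graph, the unbounded one included.) -/
def Region (D : LinkShadow C) : Type _ :=
  Quotient (Equiv.Perm.SameCycle.setoid D.nextCorner)

/-- The region that contains the corner `(c, i)`. -/
def region (D : LinkShadow C) (c : C) (i : Fin 4) : D.Region :=
  Quotient.mk (Equiv.Perm.SameCycle.setoid D.nextCorner) (c, i)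

/-- The adjacency of crossings in the projection graph (loops and multiplicities of edges are
forgotten, since this is only used for connectivity). -/
def projectionGraph (D : LinkShadow C) : SimpleGraph C :=
  SimpleGraph.fromRel fun c d => ∃ i j, D.edge (c, i) = (d, j)

end LinkShadow

/-- A link diagram with crossing set `C`, without crossingless components.  The field `planar` is
Euler's formula `V - E + F = 2 k` for the projection graph (`k` its number of connected components;
`E = 2 V` since there are four arms at each crossing), which says that every component of the
combinatorial map has genus zero, i.e. that it is a map in the plane (equivalently the sphere). -/
structure LinkDiagram (C : Type*) extends LinkShadow C where
  planar : (Nat.card C : ℤ) - 2 * Nat.card C + Nat.card toLinkShadow.Region =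
    2 * Nat.card toLinkShadow.projectionGraph.ConnectedComponent

/-- The two shades of a checkerboard coloring. -/
inductive Shade
  | black
  | white

/-- The signs of the edges of a Tait graph. -/
inductive EdgeSign
  | plus
  | minus

/-- The two ways of resolving a crossing. -/
inductive Resolution
  | A
  | B

/-- The arm that a resolution connects to the arm `i` of a crossing.  Rotating the over-strand
(arms `1`, `3`) counterclockwise sweeps out the corners `1` and `3`; the A-resolution merges these
two corners, so it connects the arms `0, 1` and the arms `2, 3`.  The B-resolution merges the
corners `0` and `2`, so it connects the arms `1, 2` and the arms `3, 0`. -/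
def Resolution.partner : Resolution → Fin 4 → Fin 4
  | .A => ![1, 0, 3, 2]
  | .B => ![3, 2, 1, 0]

namespace LinkDiagram

variable {C : Type*}

/-- The diagram is connected: its projection graph is connected. -/
def IsConnected (D : LinkDiagram C) : Prop :=
  D.projectionGraph.Connected

/-- A crossing is nugatory if it meets some region more than once. -/
def IsNugatory (D : LinkDiagram C) (c : C) : Prop :=
  ∃ i j : Fin 4, i ≠ j ∧ D.region c i = D.region c j

/-- The diagram is reduced: it has no nugatory crossings. -/
def IsReduced (D : LinkDiagram C) : Prop :=
  ∀ c, ¬ D.IsNugatory c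

/-- A checkerboard coloring: every region is black or white, and consecutive corners of a crossing
have different shades (so two opposite corners are black and the other two are white). -/
structure Checkerboard (D : LinkDiagram C) where
  shade : D.Region → Shade
  shade_ne : ∀ c i, shade (D.region c i) ≠ shade (D.region c (i + 1))

namespace Checkerboard

variable {D : LinkDiagram C}

theorem black_or (χ : D.Checkerboard) (c : C) (i : Fin 4) :
    χ.shade (D.region c i) = .black ∨ χ.shade (D.region c (i + 1)) = .black := by
  have h := χ.shade_ne c i
  cases h1 : χ.shade (D.region c i) <;> cases h2 : χ.shade (D.region c (i + 1)) <;> simp_all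

theorem eq_or_of_black (χ : D.Checkerboard) (c : C) (i j : Fin 4)
    (hi : χ.shade (D.region c i) = .black) (hj : χ.shade (D.region c j) = .black) :
    i = j ∨ i = j + 2 := by
  have h0 := χ.shade_ne c 0
  have h1 := χ.shade_ne c 1
  have h2 := χ.shade_ne c 2
  have h3 := χ.shade_ne c 3
  fin_cases i <;> fin_cases j <;> simp_all

theorem black_add_two (χ : D.Checkerboard) (c : C) (i : Fin 4)
    (hi : χ.shade (D.region c i) = .black) : χ.shade (D.region c (i + 2)) = .black := by
  have h1 := χ.shade_ne c i
  have h2 := χ.black_or c (i + 1)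
  rw [add_assoc] at h2
  rcases h2 with h2 | h2
  · exact absurd (hi.trans h2.symm) h1
  · exact h2

/-- The Tait graph: its vertices are the black regions, its edges are the crossings, and the edge
`c` joins the regions of the two opposite black corners of `c`. -/
def taitGraph (χ : D.Checkerboard) : Graph D.Region C where
  vertexSet := {r | χ.shade r = .black}
  edgeSet := Set.univ
  IsLink c x y := ∃ i : Fin 4,
    χ.shade (D.region c i) = .black ∧ x = D.region c i ∧ y = D.region c (i + 2)
  isLink_symm := by
    intro c _
    refine ⟨?_⟩
    rintro x y ⟨i, hi, rfl, rfl⟩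
    refine ⟨i + 2, χ.black_add_two c i hi, rfl, ?_⟩
    have h : i + 2 + 2 = i := by clear hi; revert i; decide
    rw [h]
  eq_or_eq_of_isLink_of_isLink := by
    rintro c _ _ _ _ ⟨i, hi, rfl, rfl⟩ ⟨j, hj, rfl, rfl⟩
    rcases χ.eq_or_of_black c i j hi hj with rfl | rfl
    · exact Or.inl rfl
    · exact Or.inr rfl
  edge_mem_iff_exists_isLink := by
    intro c
    refine ⟨fun _ => ?_, fun _ => Set.mem_univ c⟩
    rcases χ.black_or c 0 with h | h
    · exact ⟨_, _, _, h, rfl, rfl⟩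
    · exact ⟨_, _, _, h, rfl, rfl⟩
  left_mem_of_isLink := by
    rintro c _ _ ⟨i, hi, rfl, rfl⟩
    exact hi

open Classical in
/-- The sign of the edge `c` of the Tait graph: `+` if the corners merged by the A-resolution
(the corners `1` and `3`) are the black ones, and `-` if they are the white ones. -/
noncomputable def sign (χ : D.Checkerboard) (c : C) : EdgeSign :=
  if χ.shade (D.region c 1) = .black then .plus else .minus

/-- For a state `σ`, the set `E_σ` of the `(+, A)` edges and the `(-, B)` edges. -/
def stateEdges (χ : D.Checkerboard) (σ : C → Resolution) : Set C :=
  {c | (χ.sign c = .plus ∧ σ c = .A) ∨ (χ.sign c = .minus ∧ σ c = .B)}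

end Checkerboard

/-- Two arms that are consecutive along a state circle of the state `σ` (a choice of resolution at
each crossing): they are the ends of one edge of the projection graph, or the resolution of a
crossing connects them. -/
def StateStep (D : LinkDiagram C) (σ : C → Resolution) (a b : C × Fin 4) : Prop :=
  b = D.edge a ∨ b = (a.1, (σ a.1).partner a.2)

/-- The state circles of the state `σ`. -/
def StateCircle (D : LinkDiagram C) (σ : C → Resolution) : Type _ :=
  Quotient (Relation.EqvGen.setoid (D.StateStep σ))

/-- The state circle that passes through the arm `(c, i)`. -/
def stateCircle (D : LinkDiagram C) (σ : C → Resolution) (c : C) (i : Fin 4) : D.StateCircle σ :=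
  Quotient.mk (Relation.EqvGen.setoid (D.StateStep σ)) (c, i)

/-- The state segment at the crossing `c` of the state graph connects the state circles `x` and
`y`.  It joins the two arcs that replace the crossing; for either resolution, the arc through the
arm `i` and the arc through the opposite arm `i + 2` are the two different ones. -/
def SegmentConnects (D : LinkDiagram C) (σ : C → Resolution) (c : C) (x y : D.StateCircle σ) :
    Prop :=
  ∃ i : Fin 4, x = D.stateCircle σ c i ∧ y = D.stateCircle σ c (i + 2)

/-- The diagram is `σ`-adequate: no state segment connects a state circle to itself. -/
def IsAdequate (D : LinkDiagram C) (σ : C → Resolution) : Prop :=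
  ∀ (c : C) (x : D.StateCircle σ), ¬ D.SegmentConnects σ c x x

end LinkDiagram

namespace Multigraph

variable {V E : Type*}

/-- The edge `e` is contained in a cycle of the multigraph `G`: a cyclic sequence of `n ≥ 1`
distinct vertices and distinct edges, the `k`-th edge joining the `k`-th vertex to the next one
cyclically (`n = 1` is a loop, `n = 2` is a pair of parallel edges). -/
def OnCycle (G : Graph V E) (e : E) : Prop :=
  ∃ (n : ℕ) (v : Fin (n + 1) → V) (f : Fin (n + 1) → E),
    Function.Injective v ∧ Function.Injective f ∧
      (∀ k, G.IsLink (f k) (v k) (v (k + 1))) ∧ ∃ k, f k = e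

/-- The vertices `x` and `y` of `G` lie on one connected component of `G`. -/
def SameComponent (G : Graph V E) (x y : V) : Prop :=
  x ∈ G.vertexSet ∧ Relation.ReflTransGen G.Adj x y

end Multigraph

/-! Thicken the Tait graph to a ribbon graph: its half-edges are the black corners, two per
crossing, and its rotation system is the walk around the black regions. For `S = E_σ` the boundary
circles of the ribbon subgraph on `S` are the state circles (`stateCircle_corner_eq_iff`). Hence
adequacy says that the two half-edges of every edge lie on different boundary circles
(`isAdequate_iff`).

Inserting an edge multiplies the boundary permutation by the transposition of its half-edges, which
always toggles whether they share a circle (`sameCycle_boundary_insert`). The doubled genus `|S| +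
2k - f - V` is 0 for the empty set, never decreases when edges are added, and is at most 0 for the
full edge set by Euler's formula, because the circles for the empty and the full set are the black
and the white regions. So every ribbon subgraph is planar, and for `e ∉ S` the half-edges of `e`
share a circle exactly when its ends are connected in `G|S` (`sameCycle_iff_component`).

For `e ∉ E_σ` this is condition 2. For `e ∈ E_σ`, apply it to `E_σ \ {e}` and toggle: the circles
differ exactly when the ends of `e` stay connected without `e`, that is, when `e` lies on a cycle.
-/

/-! ### Merging two classes of an equivalence relation -/

/-- The equivalence relation obtained from `r` by merging the classes of `x` and `y`. -/
def Setoid.glue {X : Type*} (r : Setoid X) (x y : X) : Setoid X where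
  r u v := r u v ∨ (r u x ∧ r y v) ∨ (r u y ∧ r x v)
  iseqv :=
    { refl := fun u => Or.inl (r.refl u)
      symm := by
        rintro u v (h | ⟨h1, h2⟩ | ⟨h1, h2⟩)
        · exact Or.inl (r.symm h)
        · exact Or.inr (Or.inr ⟨r.symm h2, r.symm h1⟩)
        · exact Or.inr (Or.inl ⟨r.symm h2, r.symm h1⟩)
      trans := by
        rintro u v w (h | ⟨h1, h2⟩ | ⟨h1, h2⟩) (h' | ⟨h3, h4⟩ | ⟨h3, h4⟩)
        · exact Or.inl (r.trans h h')
        · exact Or.inr (Or.inl ⟨r.trans h h3, h4⟩)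
        · exact Or.inr (Or.inr ⟨r.trans h h3, h4⟩)
        · exact Or.inr (Or.inl ⟨h1, r.trans h2 h'⟩)
        · exact Or.inr (Or.inl ⟨h1, h4⟩)
        · exact Or.inl (r.trans h1 h4)
        · exact Or.inr (Or.inr ⟨h1, r.trans h2 h'⟩)
        · exact Or.inl (r.trans h1 h4)
        · exact Or.inr (Or.inr ⟨h1, h4⟩) }

namespace Setoid

variable {X : Type*}

theorem le_glue (r : Setoid X) (x y : X) : r ≤ r.glue x y := fun _ _ h => Or.inl h

theorem glue_rel (r : Setoid X) (x y : X) : r.glue x y x y :=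
  Or.inr (Or.inl ⟨r.refl x, r.refl y⟩)

theorem glue_le {r s : Setoid X} {x y : X} (h : r ≤ s) (hxy : s x y) : r.glue x y ≤ s := by
  rintro u v (h1 | ⟨h1, h2⟩ | ⟨h1, h2⟩)
  · exact h h1
  · exact s.trans (h h1) (s.trans hxy (h h2))
  · exact s.trans (h h1) (s.trans (s.symm hxy) (h h2))

theorem glue_eq_self {r : Setoid X} {x y : X} (h : r x y) : r.glue x y = r :=
  le_antisymm (glue_le le_rfl h) (le_glue r x y)

/-- The projection between the quotients becomes a bijection once the class of `y` is dropped; the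
class of `x` then accounts for the merged class. -/
theorem card_glue_add_one [Finite X] {r : Setoid X} {x y : X} (h : ¬ r x y) :
    Nat.card (Quotient (r.glue x y)) + 1 = Nat.card (Quotient r) := by
  let f : Quotient r → Quotient (r.glue x y) :=
    Quotient.map id fun _ _ h => Or.inl h
  have hinj : Set.InjOn f {Quotient.mk r y}ᶜ := by
    intro a ha b hb hab
    induction a using Quotient.inductionOn with | _ a
    induction b using Quotient.inductionOn with | _ b
    have ha' : ¬ r a y := fun h => ha (Quotient.sound h)
    have hb' : ¬ r b y := fun h => hb (Quotient.sound h)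
    rcases Quotient.exact hab with h1 | ⟨h1, h2⟩ | ⟨h1, h2⟩
    · exact Quotient.sound h1
    · exact absurd (r.symm h2) hb'
    · exact absurd h1 ha'
  have himg : f '' {Quotient.mk r y}ᶜ = Set.univ := by
    refine Set.eq_univ_of_forall fun a => ?_
    induction a using Quotient.inductionOn with | _ a
    by_cases ha : r a y
    · exact ⟨Quotient.mk r x, fun h' => h (Quotient.exact h'),
        Quotient.sound (Or.inr (Or.inl ⟨r.refl x, r.symm ha⟩))⟩
    · exact ⟨Quotient.mk r a, fun h' => ha (Quotient.exact h'), rfl⟩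
  rw [← Set.ncard_univ, ← himg, hinj.ncard_image, ← Set.ncard_singleton (Quotient.mk r y),
    add_comm, Set.ncard_add_ncard_compl]

end Setoid

/-! ### Cycles of a permutation multiplied by a transposition -/

namespace Equiv.Perm

theorem apply_inv_apply {X : Type*} (p : Perm X) (x : X) : p (p⁻¹ x) = x := p.apply_symm_apply x

theorem inv_apply_apply {X : Type*} (p : Perm X) (x : X) : p⁻¹ (p x) = x := p.symm_apply_apply x

theorem sameCycle_setoid_le {X : Type*} {p : Perm X} {s : Setoid X} (h : ∀ u, s u (p u)) :
    SameCycle.setoid p ≤ s := by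
  have hn (n : ℕ) (u : X) : s u ((p ^ n) u) := by
    induction n with
    | zero => exact s.refl u
    | succ n ih => rw [pow_succ', mul_apply]; exact s.trans ih (h _)
  rintro u v ⟨i, rfl⟩
  obtain ⟨n, rfl | rfl⟩ := i.eq_nat_or_neg
  · exact hn n u
  · have := hn n ((p ^ (-(n : ℤ))) u)
    rw [← mul_apply, ← zpow_natCast, ← zpow_add, add_neg_cancel, zpow_zero, one_apply] at this
    exact s.symm this

/-- Modulo `x ~ y` the transposition is invisible. As it is an involution, one inclusion gives both.
-/
theorem glue_swap_mul {X : Type*} [DecidableEq X] (p : Perm X) (x y : X) :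
    (SameCycle.setoid (swap x y * p)).glue x y = (SameCycle.setoid p).glue x y := by
  have key (p : Perm X) :
      (SameCycle.setoid (swap x y * p)).glue x y ≤ (SameCycle.setoid p).glue x y := by
    refine Setoid.glue_le (sameCycle_setoid_le fun u => ?_) (Setoid.glue_rel _ _ _)
    have hu : SameCycle p u (p u) := sameCycle_apply_right.2 (SameCycle.refl p u)
    have hs : (SameCycle.setoid p).glue x y u (p u) := Or.inl hu
    rw [mul_apply, swap_apply_def]
    split_ifs with h1 h2
    · rw [h1] at hs; exact Setoid.trans' _ hs (Setoid.glue_rel _ _ _)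
    · rw [h2] at hs; exact Setoid.trans' _ hs (Setoid.symm' _ (Setoid.glue_rel _ _ _))
    · exact hs
  refine le_antisymm (key p) ?_
  have := key (swap x y * p)
  rwa [← mul_assoc, swap_mul_self, one_mul] at this

/-- Both permutations agree along the orbit of `x` until `p` first reaches `y`; there the swap
returns to `x`, so the orbit closes up without `y`. -/
theorem not_sameCycle_swap_mul {X : Type*} [Finite X] [DecidableEq X] {p : Perm X} {x y : X} (hxy : x ≠ y)
    (h : SameCycle p x y) : ¬ SameCycle (swap x y * p) x y := by
  have hex : ∃ m : ℕ, (p ^ m) x = y := h.exists_nat_pow_eq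
  classical
  set m := Nat.find hex with hm
  have hmy : (p ^ m) x = y := Nat.find_spec hex
  have hmin : ∀ i < m, (p ^ i) x ≠ y := fun i hi => Nat.find_min hex hi
  have hm0 : 0 < m := by
    rcases Nat.eq_zero_or_pos m with h0 | h0
    · rw [h0] at hmy; exact absurd hmy hxy
    · exact h0
  have hstep (n : ℕ) : ∃ i < m, ((swap x y * p) ^ n) x = (p ^ i) x := by
    induction n with
    | zero => exact ⟨0, hm0, rfl⟩
    | succ n ih =>
      obtain ⟨i, hi, hn⟩ := ih
      rw [pow_succ', mul_apply, hn, mul_apply, ← mul_apply p, ← pow_succ']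
      rcases Nat.lt_or_ge (i + 1) m with hlt | hge
      · refine ⟨i + 1, hlt, swap_apply_of_ne_of_ne (fun hx => ?_) (hmin _ hlt)⟩
        -- A return to `x` after `i + 1` steps would make `y` reachable in fewer than `m` steps.
        refine hmin (m - (i + 1)) (by omega) ?_
        rw [← hmy]
        conv_rhs => rw [← Nat.sub_add_cancel hlt.le, pow_add, mul_apply, hx]
      · have : i + 1 = m := by omega
        rw [this, hmy]
        exact ⟨0, hm0, swap_apply_right x y⟩
  intro hs
  obtain ⟨n, hn⟩ := hs.exists_nat_pow_eq
  obtain ⟨i, hi, hi'⟩ := hstep n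
  exact hmin i hi (hi'.symm.trans hn)

theorem sameCycle_swap_mul_iff {X : Type*} [Finite X] [DecidableEq X] {p : Perm X} {x y : X} (hxy : x ≠ y) :
    SameCycle (swap x y * p) x y ↔ ¬ SameCycle p x y := by
  refine ⟨fun h h' => not_sameCycle_swap_mul hxy h' h, fun h => ?_⟩
  by_contra hq
  -- If neither cycle of `x` contains `y`, then on their common part `A` the map `p` avoids both `x`
  -- and `y`. So `A` would inject into `A \ {x}`, which is impossible for a finite set.
  let A : Set X := {u | SameCycle (swap x y * p) x u ∧ SameCycle p x u}
  have hmaps : ∀ u ∈ A, (swap x y * p) u ∈ A \ {x} := by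
    rintro u ⟨h1, h2⟩
    have h1' : SameCycle (swap x y * p) x ((swap x y * p) u) := sameCycle_apply_right.2 h1
    have h2' : SameCycle p x (p u) := sameCycle_apply_right.2 h2
    have hy : p u ≠ y := fun e => h (e ▸ h2')
    have hx : p u ≠ x := fun e => hq (by
      rw [mul_apply, e, swap_apply_left] at h1'
      exact h1')
    have he : (swap x y * p) u = p u := swap_apply_of_ne_of_ne hx hy
    exact ⟨⟨h1', he ▸ h2'⟩, fun e => hx (he.symm.trans e)⟩
  have hxA : x ∈ A := ⟨SameCycle.refl _ _, SameCycle.refl _ _⟩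
  have h1 : A.ncard ≤ (A \ {x}).ncard :=
    Set.ncard_le_ncard_of_injOn _ hmaps (swap x y * p).injective.injOn
  have h2 := Set.ncard_sdiff_singleton_lt_of_mem hxA
  omega

theorem SameCycle.of_semiconj {X Y : Type*} {p : Perm X} {q : Perm Y} {f : X → Y}
    (h : ∀ x, f (p x) = q (f x)) {x y : X} (hxy : SameCycle p x y) : SameCycle q (f x) (f y) := by
  have hle : SameCycle.setoid p ≤ (SameCycle.setoid q).comap f := sameCycle_setoid_le fun u => by
    change SameCycle q (f u) (f (p u))
    rw [h]
    exact sameCycle_apply_right.2 (SameCycle.refl _ _)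
  exact hle hxy

theorem sameCycle_iff_of_semiconj {X Y : Type*} [Finite X] {p : Perm X} {q : Perm Y} {f : X → Y}
    (hf : Function.Injective f) (h : ∀ x, f (p x) = q (f x)) {x y : X} :
    SameCycle q (f x) (f y) ↔ SameCycle p x y := by
  refine ⟨?_, SameCycle.of_semiconj h⟩
  rintro ⟨i, hi⟩
  refine ⟨i, hf ?_⟩
  rw [← hi]
  have hn (n : ℕ) (u : X) : f ((p ^ n) u) = (q ^ n) (f u) := by
    induction n with
    | zero => rfl
    | succ n ih => rw [pow_succ', mul_apply, h, ih, pow_succ', mul_apply]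
  obtain ⟨n, rfl | rfl⟩ := i.eq_nat_or_neg
  · exact hn n x
  · have := hn n ((p ^ (-(n : ℤ))) x)
    rw [← mul_apply, ← zpow_natCast, ← zpow_add, add_neg_cancel, zpow_zero, one_apply] at this
    rw [this, ← mul_apply, ← zpow_natCast, ← zpow_add, neg_add_cancel, zpow_zero, one_apply]

end Equiv.Perm

/-! ### Ribbon graphs, boundary circles and genus -/

namespace RibbonGraph

open Equiv Equiv.Perm

variable {C : Type*}

open Classical in
/-- The involution that exchanges the two half-edges of every edge in `S`. -/
noncomputable def flip (S : Set C) : Perm (C × Bool) :=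
  Function.Involutive.toPerm (fun x => if x.1 ∈ S then (x.1, !x.2) else x) (by
    rintro ⟨c, β⟩
    by_cases h : c ∈ S <;> simp [h])

theorem flip_of_mem {S : Set C} {c : C} (h : c ∈ S) (β : Bool) : flip S (c, β) = (c, !β) :=
  if_pos h

theorem flip_of_notMem {S : Set C} {c : C} (h : c ∉ S) (β : Bool) : flip S (c, β) = (c, β) :=
  if_neg h

theorem flip_empty : flip (∅ : Set C) = 1 := by
  ext1 ⟨c, β⟩
  exact flip_of_notMem (Set.notMem_empty c) β

theorem flip_insert [DecidableEq C] {S : Set C} {e : C} (he : e ∉ S) :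
    flip (insert e S) = swap (e, false) (e, true) * flip S := by
  ext1 ⟨c, β⟩
  rw [mul_apply]
  by_cases hc : c = e
  · subst hc
    rw [flip_of_mem (Set.mem_insert c S), flip_of_notMem he]
    cases β <;> simp
  · have hne (γ : Bool) : swap (e, false) (e, true) (c, γ) = (c, γ) :=
      swap_apply_of_ne_of_ne (fun h => hc (congrArg Prod.fst h)) (fun h => hc (congrArg Prod.fst h))
    by_cases hS : c ∈ S
    · rw [flip_of_mem (Set.mem_insert_of_mem e hS), flip_of_mem hS, hne]
    · rw [flip_of_notMem (by simp [hc, hS]), flip_of_notMem hS, hne]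

/-- For a ribbon graph with half-edges `C × Bool` and rotation system `p`, the permutation whose
cycles are the boundary circles of the ribbon subgraph with edge set `S`. -/
noncomputable def boundary (p : Perm (C × Bool)) (S : Set C) : Perm (C × Bool) := flip S * p

/-- Two half-edges are related if their vertices lie on one component of the spanning subgraph with
edge set `S`. -/
def component (p : Perm (C × Bool)) (S : Set C) : Setoid (C × Bool) :=
  Relation.EqvGen.setoid fun u v => SameCycle p u v ∨ (u.1 = v.1 ∧ u.1 ∈ S)

/-- The number of boundary circles. -/
noncomputable def circleCount (p : Perm (C × Bool)) (S : Set C) : ℕ :=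
  Nat.card (Quotient (SameCycle.setoid (boundary p S)))

/-- The number of components. -/
noncomputable def componentCount (p : Perm (C × Bool)) (S : Set C) : ℕ :=
  Nat.card (Quotient (component p S))

variable (p : Perm (C × Bool))

theorem sameCycle_le_component (S : Set C) : SameCycle.setoid p ≤ component p S :=
  fun _ _ h => Relation.EqvGen.rel _ _ (Or.inl h)

theorem component_of_mem {S : Set C} {c : C} (h : c ∈ S) (β γ : Bool) :
    component p S (c, β) (c, γ) :=
  Relation.EqvGen.rel _ _ (Or.inr ⟨rfl, h⟩)

theorem component_empty : component p ∅ = SameCycle.setoid p := by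
  refine le_antisymm (Setoid.eqvGen_le ?_) (sameCycle_le_component p ∅)
  rintro u v (h | ⟨_, h⟩)
  · exact h
  · exact h.elim

theorem component_insert (S : Set C) (e : C) :
    component p (insert e S) = (component p S).glue (e, false) (e, true) := by
  apply le_antisymm
  · refine Setoid.eqvGen_le ?_
    rintro ⟨c, β⟩ ⟨d, γ⟩ (h | ⟨h, rfl | h'⟩)
    · exact Setoid.le_glue _ _ _ (sameCycle_le_component p S h)
    · obtain rfl : c = d := h
      have hg := Setoid.glue_rel (component p S) (c, false) (c, true)
      cases β <;> cases γ
      · exact Setoid.refl' _ _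
      · exact hg
      · exact Setoid.symm' _ hg
      · exact Setoid.refl' _ _
    · obtain rfl : c = d := h
      exact Setoid.le_glue _ _ _ (component_of_mem p h' β γ)
  · refine Setoid.glue_le (Setoid.eqvGen_le ?_) (component_of_mem p (Set.mem_insert e S) _ _)
    rintro ⟨c, β⟩ ⟨d, γ⟩ (h | ⟨h, h'⟩)
    · exact sameCycle_le_component p _ h
    · obtain rfl : c = d := h
      exact component_of_mem p (Set.mem_insert_of_mem e h') β γ

theorem circle_le_component (S : Set C) : SameCycle.setoid (boundary p S) ≤ component p S := by
  refine sameCycle_setoid_le fun u => ?_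
  have hu : component p S u (p u) :=
    sameCycle_le_component p S (sameCycle_apply_right.2 (SameCycle.refl p u))
  rw [boundary, mul_apply]
  generalize p u = v at hu ⊢
  obtain ⟨c, β⟩ := v
  by_cases hc : c ∈ S
  · rw [flip_of_mem hc]
    exact Setoid.trans' _ hu (component_of_mem p hc _ _)
  · rwa [flip_of_notMem hc]

theorem boundary_insert [DecidableEq C] {S : Set C} {e : C} (he : e ∉ S) :
    boundary p (insert e S) = swap (e, false) (e, true) * boundary p S := by
  rw [boundary, flip_insert he, mul_assoc, boundary]

theorem componentCount_insert_of_component {S : Set C} {e : C}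
    (h : component p S (e, false) (e, true)) :
    componentCount p (insert e S) = componentCount p S := by
  rw [componentCount, component_insert, Setoid.glue_eq_self h, componentCount]

/-- Twice the genus of the ribbon subgraph with edge set `S`. -/
noncomputable def doubleGenus (S : Set C) : ℤ :=
  S.ncard + 2 * componentCount p S - circleCount p S - circleCount p ∅

theorem doubleGenus_empty : doubleGenus p ∅ = 0 := by
  have h : componentCount p ∅ = circleCount p ∅ := by
    rw [componentCount, circleCount, component_empty, boundary, flip_empty, one_mul]
  rw [doubleGenus, h, Set.ncard_empty]
  push_cast
  ring

variable [Finite C]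

theorem sameCycle_boundary_insert {S : Set C} {e : C} (he : e ∉ S) :
    SameCycle (boundary p (insert e S)) (e, false) (e, true) ↔
      ¬ SameCycle (boundary p S) (e, false) (e, true) := by
  classical
  rw [boundary_insert p he]
  exact sameCycle_swap_mul_iff (by simp)

/-- Gluing the two half-edges gives the same relation before and after the insertion. It is trivial
on the side where they share a circle and merges two classes on the other. -/
theorem circleCount_insert_of_not {S : Set C} {e : C} (he : e ∉ S)
    (h : ¬ SameCycle (boundary p S) (e, false) (e, true)) :
    circleCount p (insert e S) + 1 = circleCount p S := by
  classical
  have h' := (sameCycle_boundary_insert p he).2 h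
  have h1 := Setoid.card_glue_add_one (r := SameCycle.setoid (boundary p S)) h
  rw [← glue_swap_mul, ← boundary_insert p he,
    Setoid.glue_eq_self (r := SameCycle.setoid (boundary p (insert e S))) h'] at h1
  exact h1

theorem circleCount_insert_of_sameCycle {S : Set C} {e : C} (he : e ∉ S)
    (h : SameCycle (boundary p S) (e, false) (e, true)) :
    circleCount p (insert e S) = circleCount p S + 1 := by
  classical
  have h' : ¬ SameCycle (boundary p (insert e S)) (e, false) (e, true) :=
    fun h' => (sameCycle_boundary_insert p he).1 h' h
  have h1 := Setoid.card_glue_add_one (r := SameCycle.setoid (boundary p (insert e S))) h'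
  rw [boundary_insert p he, glue_swap_mul,
    Setoid.glue_eq_self (r := SameCycle.setoid (boundary p S)) h, ← boundary_insert p he] at h1
  exact h1.symm

theorem componentCount_insert_of_not {S : Set C} {e : C}
    (h : ¬ component p S (e, false) (e, true)) :
    componentCount p (insert e S) + 1 = componentCount p S := by
  rw [componentCount, component_insert, Setoid.card_glue_add_one h, componentCount]

/-- A new edge inside a component either splits a circle, which offsets the edge, or merges two
circles, which costs 2. An edge between components loses one component and one circle, and these
balance. -/
theorem doubleGenus_insert {S : Set C} {e : C} (he : e ∉ S) :
    doubleGenus p (insert e S) = doubleGenus p S ∨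
      (¬ SameCycle (boundary p S) (e, false) (e, true) ∧ component p S (e, false) (e, true) ∧
        doubleGenus p (insert e S) = doubleGenus p S + 2) := by
  have hc := Set.ncard_insert_of_notMem he
  by_cases hk : component p S (e, false) (e, true)
  · have h1 := componentCount_insert_of_component p hk
    by_cases hd : SameCycle (boundary p S) (e, false) (e, true)
    · have h2 := circleCount_insert_of_sameCycle p he hd
      left; simp only [doubleGenus]; omega
    · have h2 := circleCount_insert_of_not p he hd
      right; refine ⟨hd, hk, ?_⟩; simp only [doubleGenus]; omega
  · have hd : ¬ SameCycle (boundary p S) (e, false) (e, true) :=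
      fun h => hk (circle_le_component p S h)
    have h1 := componentCount_insert_of_not p hk
    have h2 := circleCount_insert_of_not p he hd
    left; simp only [doubleGenus]; omega

theorem doubleGenus_mono {S T : Set C} (h : S ⊆ T) : doubleGenus p S ≤ doubleGenus p T := by
  have key : ∀ U : Set C, doubleGenus p S ≤ doubleGenus p (S ∪ U) := by
    intro U
    induction U, U.toFinite using Set.Finite.induction_on with
    | empty => rw [Set.union_empty]
    | @insert a U _ _ ih =>
      rw [Set.union_insert]
      by_cases ha : a ∈ S ∪ U
      · rwa [Set.insert_eq_of_mem ha]
      · rcases doubleGenus_insert p ha with h' | ⟨_, _, h'⟩ <;> omega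
  simpa [Set.union_eq_self_of_subset_left h] using key T

/-- In a plane ribbon graph, the two sides of a new edge lie on one boundary circle if and only if
its ends lie on one component. -/
theorem sameCycle_iff_component (hp : doubleGenus p Set.univ ≤ 0) {S : Set C} {e : C}
    (he : e ∉ S) :
    SameCycle (boundary p S) (e, false) (e, true) ↔ component p S (e, false) (e, true) := by
  refine ⟨fun h => circle_le_component p S h, fun h => ?_⟩
  -- Merging two circles within one component would raise the doubled genus from at least 0 to at
  -- least 2, above its bound for the full edge set.
  by_contra hd
  have h0 := doubleGenus_mono p (Set.empty_subset S)
  have h1 := doubleGenus_mono p (Set.subset_univ (insert e S))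
  have h2 := circleCount_insert_of_not p he hd
  have h3 := componentCount_insert_of_component p h
  have hc := Set.ncard_insert_of_notMem he
  rw [doubleGenus_empty] at h0
  simp only [doubleGenus] at h0 h1 hp
  omega

end RibbonGraph

/-! ### The Tait graph as a plane ribbon graph -/

namespace LinkDiagram

open Equiv Equiv.Perm LinkShadow

variable {C : Type*}

theorem turn_apply (a : C × Fin 4) : turn C a = (a.1, a.2 + 1) := rfl

namespace Checkerboard

variable {D : LinkDiagram C} (χ : D.Checkerboard)

/-- The corner is black; equivalently, black is on the left when leaving along the arm. -/
def IsBlack (a : C × Fin 4) : Prop := χ.shade (D.region a.1 a.2) = .black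

theorem isBlack_nextCorner (a : C × Fin 4) : χ.IsBlack (D.nextCorner a) ↔ χ.IsBlack a := by
  have h : D.region (D.nextCorner a).1 (D.nextCorner a).2 = D.region a.1 a.2 :=
    Quotient.sound (s := SameCycle.setoid D.nextCorner)
      (sameCycle_apply_left.2 (SameCycle.refl _ _))
  rw [IsBlack, h, IsBlack]

theorem isBlack_turn (a : C × Fin 4) : χ.IsBlack (turn C a) ↔ ¬ χ.IsBlack a := by
  obtain ⟨c, i⟩ := a
  have h1 := χ.shade_ne c i
  have h2 := χ.black_or c i
  change χ.shade (D.region c (i + 1)) = .black ↔ ¬ χ.shade (D.region c i) = .black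
  refine ⟨fun h h' => h1 (h'.trans h.symm), fun h => h2.resolve_left h⟩

theorem isBlack_turn_inv (a : C × Fin 4) : χ.IsBlack ((turn C)⁻¹ a) ↔ ¬ χ.IsBlack a := by
  have := χ.isBlack_turn ((turn C)⁻¹ a)
  rw [apply_inv_apply] at this
  tauto

theorem isBlack_edge (a : C × Fin 4) : χ.IsBlack (D.edge a) ↔ ¬ χ.IsBlack a := by
  rw [← χ.isBlack_nextCorner a, nextCorner, mul_apply, isBlack_turn_inv, not_not]

open Classical in
/-- A black corner of the crossing. -/
noncomputable def blackArm (c : C) : Fin 4 := if χ.IsBlack (c, 0) then 0 else 1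

theorem isBlack_blackArm (c : C) : χ.IsBlack (c, χ.blackArm c) := by
  rw [blackArm]
  split_ifs with h
  · exact h
  · exact (χ.isBlack_turn (c, 0)).2 h

/-- The black corners, listed as half-edges of the Tait graph. -/
noncomputable def corner (x : C × Bool) : C × Fin 4 :=
  (x.1, χ.blackArm x.1 + bif x.2 then 2 else 0)

theorem turn_turn_corner (c : C) (β : Bool) :
    turn C (turn C (χ.corner (c, β))) = χ.corner (c, !β) := by
  simp only [turn_apply, corner, Prod.mk.injEq, true_and]
  generalize χ.blackArm c = k
  cases β <;> revert k <;> decide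

theorem corner_injective : Function.Injective χ.corner := by
  rintro ⟨c, β⟩ ⟨d, γ⟩ h
  obtain rfl : c = d := congrArg Prod.fst h
  have h2 : (bif β then 2 else 0 : Fin 4) = bif γ then 2 else 0 :=
    add_left_cancel (congrArg Prod.snd h : χ.blackArm c + _ = χ.blackArm c + _)
  cases β <;> cases γ <;> simp_all

theorem isBlack_corner (x : C × Bool) : χ.IsBlack (χ.corner x) := by
  obtain ⟨c, β⟩ := x
  have h : χ.IsBlack (χ.corner (c, false)) := by
    simpa [corner] using χ.isBlack_blackArm c
  cases β
  · exact h
  · rw [← Bool.not_false, ← turn_turn_corner, isBlack_turn, isBlack_turn, not_not]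
    exact h

theorem exists_corner_eq {a : C × Fin 4} (h : χ.IsBlack a) : ∃ x, χ.corner x = a := by
  obtain ⟨c, i⟩ := a
  rcases χ.eq_or_of_black c i (χ.blackArm c) h (χ.isBlack_blackArm c) with h' | h'
  · exact ⟨(c, false), by simp [corner, h']⟩
  · exact ⟨(c, true), by simp [corner, h']⟩

section Finite

variable [Finite C]

/-- The permutation of the black corners that walks around the black regions. -/
noncomputable def blackNext : Perm (C × Bool) :=
  Equiv.ofBijective
    (fun x => (χ.exists_corner_eq ((χ.isBlack_nextCorner _).2 (χ.isBlack_corner x))).choose) <| by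
    rw [← Finite.injective_iff_bijective]
    intro x y h
    have hx := (χ.exists_corner_eq ((χ.isBlack_nextCorner _).2 (χ.isBlack_corner x))).choose_spec
    have hy := (χ.exists_corner_eq ((χ.isBlack_nextCorner _).2 (χ.isBlack_corner y))).choose_spec
    simp only at h
    rw [h, hy] at hx
    exact χ.corner_injective (D.nextCorner.injective hx.symm)

theorem corner_blackNext (x : C × Bool) : χ.corner (χ.blackNext x) = D.nextCorner (χ.corner x) :=
  (χ.exists_corner_eq ((χ.isBlack_nextCorner _).2 (χ.isBlack_corner x))).choose_spec

theorem blackNext_fst (x : C × Bool) : (χ.blackNext x).1 = (D.edge (χ.corner x)).1 :=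
  congrArg Prod.fst (χ.corner_blackNext x)

theorem corner_boundary_of_notMem {S : Set C} {x : C × Bool} (h : (D.edge (χ.corner x)).1 ∉ S) :
    χ.corner (RibbonGraph.boundary χ.blackNext S x) = (turn C)⁻¹ (D.edge (χ.corner x)) := by
  rw [← χ.blackNext_fst] at h
  rw [RibbonGraph.boundary, mul_apply, ← Prod.mk.eta (p := χ.blackNext x),
    RibbonGraph.flip_of_notMem h, Prod.mk.eta, corner_blackNext, nextCorner, mul_apply]

/-- The flip passes to the opposite black corner, two turns away, so the clockwise turn of
`nextCorner` becomes a counterclockwise one. -/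
theorem corner_boundary_of_mem {S : Set C} {x : C × Bool} (h : (D.edge (χ.corner x)).1 ∈ S) :
    χ.corner (RibbonGraph.boundary χ.blackNext S x) = turn C (D.edge (χ.corner x)) := by
  rw [← χ.blackNext_fst] at h
  rw [RibbonGraph.boundary, mul_apply, ← Prod.mk.eta (p := χ.blackNext x),
    RibbonGraph.flip_of_mem h, ← turn_turn_corner, Prod.mk.eta, corner_blackNext, nextCorner,
    mul_apply, apply_inv_apply]

theorem corner_boundary_empty (x : C × Bool) :
    χ.corner (RibbonGraph.boundary χ.blackNext ∅ x) = D.nextCorner (χ.corner x) :=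
  χ.corner_boundary_of_notMem (Set.notMem_empty _)

/-- The boundary circles of the full ribbon graph run around the white regions in the opposite
direction, hence the inverse; each white corner is one clockwise turn from a black one. -/
theorem turn_inv_corner_boundary_univ_inv (x : C × Bool) :
    (turn C)⁻¹ (χ.corner ((RibbonGraph.boundary χ.blackNext Set.univ)⁻¹ x)) =
      D.nextCorner ((turn C)⁻¹ (χ.corner x)) := by
  obtain ⟨y, rfl⟩ := (RibbonGraph.boundary χ.blackNext Set.univ).surjective x
  rw [inv_apply_apply, χ.corner_boundary_of_mem (Set.mem_univ _), inv_apply_apply, nextCorner,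
    mul_apply, D.edge_edge]

/-- The circles for the empty set are the black regions (`f`), those for the full set the white ones
(`g`). -/
theorem circleCount_empty_add_univ :
    RibbonGraph.circleCount χ.blackNext ∅ + RibbonGraph.circleCount χ.blackNext Set.univ =
      Nat.card D.Region := by
  let f : Quotient (SameCycle.setoid (RibbonGraph.boundary χ.blackNext ∅)) → D.Region :=
    Quotient.map χ.corner fun _ _ h => SameCycle.of_semiconj χ.corner_boundary_empty h
  let g : Quotient (SameCycle.setoid (RibbonGraph.boundary χ.blackNext Set.univ)) → D.Region :=
    Quotient.map (fun x => (turn C)⁻¹ (χ.corner x)) fun a b h =>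
      have h' : SameCycle (RibbonGraph.boundary χ.blackNext Set.univ) a b := h
      SameCycle.of_semiconj (f := fun x => (turn C)⁻¹ (χ.corner x))
        χ.turn_inv_corner_boundary_univ_inv h'.inv
  have hf (x : C × Bool) : χ.shade (f (Quotient.mk _ x)) = .black := χ.isBlack_corner x
  have hg (x : C × Bool) : χ.shade (g (Quotient.mk _ x)) ≠ .black :=
    fun h => (χ.isBlack_turn_inv (χ.corner x)).1 h (χ.isBlack_corner x)
  rw [RibbonGraph.circleCount, RibbonGraph.circleCount, ← Nat.card_sum]
  refine Nat.card_congr (Equiv.ofBijective (Sum.elim f g) ⟨?_, ?_⟩)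
  · refine Function.Injective.sumElim ?_ ?_ ?_
    · intro x y h
      induction x using Quotient.inductionOn with | _ x
      induction y using Quotient.inductionOn with | _ y
      exact Quotient.sound ((sameCycle_iff_of_semiconj χ.corner_injective
        χ.corner_boundary_empty).1 (Quotient.exact h))
    · intro x y h
      induction x using Quotient.inductionOn with | _ x
      induction y using Quotient.inductionOn with | _ y
      exact Quotient.sound (sameCycle_inv.1 ((sameCycle_iff_of_semiconj
        ((turn C)⁻¹.injective.comp χ.corner_injective)
        χ.turn_inv_corner_boundary_univ_inv).1 (Quotient.exact h)))
    · intro x y h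
      induction x using Quotient.inductionOn with | _ x
      induction y using Quotient.inductionOn with | _ y
      exact hg y (h ▸ hf x)
  · intro r
    induction r using Quotient.inductionOn with | _ a
    by_cases ha : χ.IsBlack a
    · obtain ⟨x, rfl⟩ := χ.exists_corner_eq ha
      exact ⟨Sum.inl (Quotient.mk _ x), rfl⟩
    · obtain ⟨x, hx⟩ := χ.exists_corner_eq ((χ.isBlack_turn a).2 ha)
      refine ⟨Sum.inr (Quotient.mk _ x), ?_⟩
      change Quotient.mk _ ((turn C)⁻¹ (χ.corner x)) = _
      rw [hx, inv_apply_apply]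

theorem component_univ_of_edge {c d : C} {i j : Fin 4} (h : D.edge (c, i) = (d, j)) (β γ : Bool) :
    RibbonGraph.component χ.blackNext Set.univ (c, β) (d, γ) := by
  have key {c d : C} {i j : Fin 4} (h : D.edge (c, i) = (d, j)) (hb : χ.IsBlack (c, i))
      (β γ : Bool) : RibbonGraph.component χ.blackNext Set.univ (c, β) (d, γ) := by
    obtain ⟨⟨c', δ⟩, hx⟩ := χ.exists_corner_eq hb
    obtain rfl : c' = c := congrArg Prod.fst hx
    have hd := χ.blackNext_fst (c', δ)
    rw [hx, h] at hd
    have h1 : RibbonGraph.component χ.blackNext Set.univ (c', δ) (χ.blackNext (c', δ)) :=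
      RibbonGraph.sameCycle_le_component _ _ (sameCycle_apply_right.2 (SameCycle.refl _ _))
    rw [← Prod.mk.eta (p := χ.blackNext (c', δ)), hd] at h1
    exact Setoid.trans' _ (RibbonGraph.component_of_mem _ (Set.mem_univ _) _ _)
      (Setoid.trans' _ h1 (RibbonGraph.component_of_mem _ (Set.mem_univ _) _ _))
  -- Exactly one end of an edge has black on its left; reverse the edge if it is the other one.
  by_cases hb : χ.IsBlack (c, i)
  · exact key h hb β γ
  · have h' : D.edge (d, j) = (c, i) := by rw [← h, D.edge_edge]
    exact Setoid.symm' _ (key h' (h ▸ (χ.isBlack_edge _).2 hb) γ β)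

theorem component_univ (hconn : D.IsConnected) (x y : C × Bool) :
    RibbonGraph.component χ.blackNext Set.univ x y := by
  obtain ⟨c, β⟩ := x
  obtain ⟨d, γ⟩ := y
  obtain ⟨w⟩ := hconn.preconnected c d
  induction w generalizing β with
  | nil => exact RibbonGraph.component_of_mem _ (Set.mem_univ _) _ _
  | cons h _ ih =>
    refine Setoid.trans' _ ?_ (ih false)
    rcases ((SimpleGraph.fromRel_adj _ _ _).1 h).2 with ⟨i, j, h'⟩ | ⟨i, j, h'⟩
    · exact χ.component_univ_of_edge h' _ _
    · exact Setoid.symm' _ (χ.component_univ_of_edge h' _ _)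

/-- With one component, Euler's formula gives `|C| + 2` regions, which cancels the term `|C| + 2k`.
-/
theorem doubleGenus_univ_le (hconn : D.IsConnected) :
    RibbonGraph.doubleGenus χ.blackNext Set.univ ≤ 0 := by
  have h1 := χ.circleCount_empty_add_univ
  have h2 : Nat.card D.projectionGraph.ConnectedComponent = 1 := by
    have := hconn.preconnected.subsingleton_connectedComponent
    have := hconn.nonempty
    have : Nonempty D.projectionGraph.ConnectedComponent :=
      this.map D.projectionGraph.connectedComponentMk
    exact Nat.card_unique
  have h3 : RibbonGraph.componentCount χ.blackNext Set.univ ≤ 1 := by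
    have : Subsingleton (Quotient (RibbonGraph.component χ.blackNext Set.univ)) := by
      refine ⟨fun a b => ?_⟩
      induction a using Quotient.inductionOn with | _ a
      induction b using Quotient.inductionOn with | _ b
      exact Quotient.sound (χ.component_univ hconn a b)
    exact Finite.card_le_one_iff_subsingleton.2 this
  have h4 := D.planar
  rw [h2] at h4
  rw [RibbonGraph.doubleGenus, Set.ncard_univ]
  omega

end Finite

/-! ### State circles as boundary circles -/

/-- On `E_σ` the black corners are merged, so the arcs cut off the white ones and the arm is joined
across the white corner on its left. Otherwise it is joined across the black corner on its right. -/
theorem partner_of_not_isBlack (σ : C → Resolution) {a : C × Fin 4} (ha : ¬ χ.IsBlack a) :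
    (a.1 ∈ χ.stateEdges σ → (a.1, (σ a.1).partner a.2) = turn C a) ∧
      (a.1 ∉ χ.stateEdges σ → (a.1, (σ a.1).partner a.2) = (turn C)⁻¹ a) := by
  obtain ⟨c, i⟩ := a
  have h0 := χ.isBlack_turn (c, 0)
  have h1 := χ.isBlack_turn (c, 1)
  have h2 := χ.isBlack_turn (c, 2)
  have e0 : turn C (c, 0) = (c, 1) := rfl
  have e1 : turn C (c, 1) = (c, 2) := rfl
  have e2 : turn C (c, 2) = (c, 3) := rfl
  have e3 : turn C (c, 3) = (c, 0) := rfl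
  have hS : c ∈ χ.stateEdges σ ↔ (χ.IsBlack (c, 1) ↔ σ c = .A) := by
    by_cases hb : χ.IsBlack (c, 1)
    · have : χ.sign c = .plus := if_pos hb
      simp [stateEdges, this, hb]
    · have : χ.sign c = .minus := if_neg hb
      cases h : σ c <;> simp [stateEdges, this, hb, h]
  rw [e0] at h0
  rw [e1] at h1
  rw [e2] at h2
  simp only [hS, Perm.eq_inv_iff_eq]
  cases h : σ c <;> fin_cases i <;> simp_all [Resolution.partner]

theorem partner_eq_turn_or (r : Resolution) (a : C × Fin 4) :
    (a.1, r.partner a.2) = turn C a ∨ (a.1, r.partner a.2) = (turn C)⁻¹ a := by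
  obtain ⟨c, i⟩ := a
  rw [Perm.eq_inv_iff_eq, turn_apply, turn_apply]
  cases r <;> fin_cases i <;> simp [Resolution.partner]

theorem partner_partner (r : Resolution) (i : Fin 4) : r.partner (r.partner i) = i := by
  cases r <;> fin_cases i <;> rfl

theorem isBlack_partner (r : Resolution) (a : C × Fin 4) :
    χ.IsBlack (a.1, r.partner a.2) ↔ ¬ χ.IsBlack a := by
  rcases partner_eq_turn_or r a with h | h
  · rw [h, isBlack_turn]
  · rw [h, isBlack_turn_inv]

theorem exists_corner_eq_or_edge (a : C × Fin 4) : ∃ x, χ.corner x = a ∨ χ.corner x = D.edge a := by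
  by_cases ha : χ.IsBlack a
  · exact (χ.exists_corner_eq ha).imp fun _ => Or.inl
  · exact (χ.exists_corner_eq ((χ.isBlack_edge a).2 ha)).imp fun _ => Or.inr

/-- The black corner from which one leaves along the edge that contains the arm `a`. -/
noncomputable def cornerOfArm (a : C × Fin 4) : C × Bool := (χ.exists_corner_eq_or_edge a).choose

theorem cornerOfArm_eq {a : C × Fin 4} {x : C × Bool}
    (h : χ.corner x = a ∨ χ.corner x = D.edge a) : χ.cornerOfArm a = x := by
  have h1 : χ.corner (χ.cornerOfArm a) = a ∨ χ.corner (χ.cornerOfArm a) = D.edge a :=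
    (χ.exists_corner_eq_or_edge a).choose_spec
  have hx := χ.isBlack_corner x
  have hr := χ.isBlack_corner (χ.cornerOfArm a)
  have he := χ.isBlack_edge a
  refine χ.corner_injective ?_
  rcases h with h | h <;> rcases h1 with h1 | h1 <;> rw [h] at hx ⊢ <;> rw [h1] at hr ⊢ <;> tauto

/-- The vertex of the Tait graph at a half-edge. -/
noncomputable def vertex (x : C × Bool) : D.Region := D.region (χ.corner x).1 (χ.corner x).2

theorem taitGraph_isLink_iff (c : C) (u v : D.Region) :
    χ.taitGraph.IsLink c u v ↔ ∃ β, u = χ.vertex (c, β) ∧ v = χ.vertex (c, !β) := by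
  have h2 (β : Bool) : D.region c ((χ.corner (c, β)).2 + 2) = χ.vertex (c, !β) := by
    rw [vertex, ← turn_turn_corner, turn_apply, turn_apply, add_assoc]
    rfl
  constructor
  · rintro ⟨i, hi, rfl, rfl⟩
    obtain ⟨⟨c', β⟩, hx⟩ := χ.exists_corner_eq (a := (c, i)) hi
    obtain rfl : c' = c := congrArg Prod.fst hx
    refine ⟨β, ?_, ?_⟩
    · rw [vertex, hx]
    · rw [← h2, hx]
  · rintro ⟨β, rfl, rfl⟩
    exact ⟨(χ.corner (c, β)).2, χ.isBlack_corner (c, β), rfl, (h2 β).symm⟩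

section Finite

variable [Finite C] (σ : C → Resolution)

theorem corner_boundary_stateEdges (x : C × Bool) :
    χ.corner (RibbonGraph.boundary χ.blackNext (χ.stateEdges σ) x) =
      ((D.edge (χ.corner x)).1, (σ (D.edge (χ.corner x)).1).partner (D.edge (χ.corner x)).2) := by
  have h := χ.partner_of_not_isBlack σ
    (fun h => (χ.isBlack_edge (χ.corner x)).1 h (χ.isBlack_corner x))
  by_cases hS : (D.edge (χ.corner x)).1 ∈ χ.stateEdges σ
  · rw [χ.corner_boundary_of_mem hS, h.1 hS]
  · rw [χ.corner_boundary_of_notMem hS, h.2 hS]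

/-- A state circle alternates edges and resolution arcs, and each edge has one black arm.
`cornerOfArm` is constant along an edge and moves by one boundary step, forwards or backwards, along
an arc. -/
theorem stateCircle_corner_eq_iff (x y : C × Bool) :
    D.stateCircle σ (χ.corner x).1 (χ.corner x).2 = D.stateCircle σ (χ.corner y).1 (χ.corner y).2 ↔
      SameCycle (RibbonGraph.boundary χ.blackNext (χ.stateEdges σ)) x y := by
  constructor
  · intro h
    have hle : Relation.EqvGen.setoid (D.StateStep σ) ≤ (SameCycle.setoid
        (RibbonGraph.boundary χ.blackNext (χ.stateEdges σ))).comap χ.cornerOfArm := by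
      refine Setoid.eqvGen_le fun a b hab => ?_
      change SameCycle _ _ _
      rcases hab with rfl | rfl
      · obtain ⟨x, hx⟩ := χ.exists_corner_eq_or_edge a
        rw [χ.cornerOfArm_eq hx, χ.cornerOfArm_eq (x := x)]
        rw [D.edge_edge]
        exact hx.symm
      · have key (a : C × Fin 4) (ha : ¬ χ.IsBlack a) :
            SameCycle (RibbonGraph.boundary χ.blackNext (χ.stateEdges σ)) (χ.cornerOfArm a)
              (χ.cornerOfArm (a.1, (σ a.1).partner a.2)) := by
          obtain ⟨x, hx⟩ := χ.exists_corner_eq ((χ.isBlack_edge a).2 ha)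
          have hb := χ.corner_boundary_stateEdges σ x
          rw [hx, D.edge_edge] at hb
          rw [χ.cornerOfArm_eq (Or.inr hx), χ.cornerOfArm_eq (Or.inl hb)]
          exact sameCycle_apply_right.2 (SameCycle.refl _ _)
        by_cases ha : χ.IsBlack a
        · have := key (a.1, (σ a.1).partner a.2) fun h => (χ.isBlack_partner _ a).1 h ha
          rw [partner_partner] at this
          exact this.symm
        · exact key a ha
    have h2 := hle (Quotient.exact h)
    change SameCycle _ _ _ at h2
    rwa [χ.cornerOfArm_eq (Or.inl rfl), χ.cornerOfArm_eq (Or.inl rfl)] at h2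
  · intro h
    have hle : SameCycle.setoid (RibbonGraph.boundary χ.blackNext (χ.stateEdges σ)) ≤
        (Relation.EqvGen.setoid (D.StateStep σ)).comap χ.corner := by
      refine sameCycle_setoid_le fun u => ?_
      change Relation.EqvGen _ _ _
      rw [corner_boundary_stateEdges]
      exact Relation.EqvGen.trans _ _ _ (Relation.EqvGen.rel _ _ (Or.inl rfl))
        (Relation.EqvGen.rel _ _ (Or.inr rfl))
    exact Quotient.sound (hle h)

theorem exists_segmentConnects_self_iff (c : C) :
    (∃ z, D.SegmentConnects σ c z z) ↔
      SameCycle (RibbonGraph.boundary χ.blackNext (χ.stateEdges σ)) (c, false) (c, true) := by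
  rw [← stateCircle_corner_eq_iff]
  have h2 : χ.corner (c, true) = (c, χ.blackArm c + 2) := rfl
  have h0 : χ.corner (c, false) = (c, χ.blackArm c) := by simp [corner]
  rw [h2, h0]
  constructor
  · rintro ⟨z, i, h, h'⟩
    have hi := h.symm.trans h'
    have hp (j : Fin 4) : D.stateCircle σ c ((σ c).partner j) = D.stateCircle σ c j :=
      Quotient.sound (Relation.EqvGen.symm _ _ (Relation.EqvGen.rel _ _ (Or.inr rfl)))
    have h4 : (σ c).partner (i + 2) = (σ c).partner i + 2 := by
      cases σ c <;> fin_cases i <;> rfl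
    have key (j : Fin 4) (hj : D.stateCircle σ c j = D.stateCircle σ c (j + 2))
        (hb : χ.IsBlack (c, j)) :
        D.stateCircle σ c (χ.blackArm c) = D.stateCircle σ c (χ.blackArm c + 2) := by
      rcases χ.eq_or_of_black c (χ.blackArm c) j (χ.isBlack_blackArm c) hb with e | e
      · rwa [e]
      · rw [e, add_assoc]
        simpa using hj.symm
    by_cases hb : χ.IsBlack (c, i)
    · exact key i hi hb
    -- A white arm is exchanged for its resolution partner: it is black, lies on the same circle,
    -- and opposite arms have opposite partners.
    · refine key ((σ c).partner i) ?_ ((χ.isBlack_partner (σ c) (c, i)).2 hb)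
      rw [← h4, hp, hp, hi]
  · exact fun h => ⟨_, χ.blackArm c, rfl, h⟩

theorem isAdequate_iff :
    D.IsAdequate σ ↔ ∀ c, ¬ SameCycle (RibbonGraph.boundary χ.blackNext (χ.stateEdges σ))
      (c, false) (c, true) := by
  refine forall_congr' fun c => ?_
  rw [← exists_segmentConnects_self_iff, not_exists]

theorem vertex_eq_iff (x y : C × Bool) : χ.vertex x = χ.vertex y ↔ SameCycle χ.blackNext x y := by
  rw [← sameCycle_iff_of_semiconj χ.corner_injective χ.corner_blackNext]
  exact Quotient.eq

theorem component_iff_reflTransGen (S : Set C) (x y : C × Bool) :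
    RibbonGraph.component χ.blackNext S x y ↔
      Relation.ReflTransGen (χ.taitGraph.restrict S).Adj (χ.vertex x) (χ.vertex y) := by
  constructor
  · intro h
    let s : Setoid D.Region := ⟨Relation.ReflTransGen (χ.taitGraph.restrict S).Adj,
      ⟨fun _ => .refl, fun h => Std.Symm.symm _ _ h, fun h h' => h.trans h'⟩⟩
    have hle : RibbonGraph.component χ.blackNext S ≤ s.comap χ.vertex := by
      refine Setoid.eqvGen_le ?_
      rintro ⟨c, β⟩ ⟨d, γ⟩ (h | ⟨h, hS⟩)
      · change s _ _
        rw [(χ.vertex_eq_iff _ _).2 h]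
      · obtain rfl : c = d := h
        by_cases hβ : γ = β
        · rw [hβ]
        · obtain rfl : γ = !β := by cases β <;> cases γ <;> simp_all
          exact Relation.ReflTransGen.single
            ⟨c, hS, (χ.taitGraph_isLink_iff _ _ _).2 ⟨β, rfl, rfl⟩⟩
    exact hle h
  · intro h
    generalize hv : χ.vertex y = v at h
    induction h generalizing y with
    | refl => exact RibbonGraph.sameCycle_le_component _ _ ((χ.vertex_eq_iff _ _).1 hv.symm)
    | tail _ hadj ih =>
      obtain ⟨c, hS, hl⟩ := hadj
      obtain ⟨β, rfl, rfl⟩ := (χ.taitGraph_isLink_iff _ _ _).1 hl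
      refine Setoid.trans' _ (ih _ rfl) (Setoid.trans' _
        (RibbonGraph.component_of_mem _ hS _ _)
        (RibbonGraph.sameCycle_le_component _ _ ((χ.vertex_eq_iff _ _).1 hv.symm)))

end Finite

end Checkerboard

end LinkDiagram

/-! ### Cycles through an edge and connectivity without it -/

namespace Multigraph

variable {V E : Type*} {G : Graph V E}

open Fin.CommRing in
theorem reflTransGen_adj_of_onCycle {e : E} (h : OnCycle G e) :
    ∃ x y, G.IsLink e x y ∧ Relation.ReflTransGen (G.restrict {e}ᶜ).Adj y x := by
  obtain ⟨n, v, f, -, hf, hl, k, rfl⟩ := h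
  refine ⟨v k, v (k + 1), hl k, ?_⟩
  have key : ∀ i : ℕ, i ≤ n →
      Relation.ReflTransGen (G.restrict {f k}ᶜ).Adj (v (k + 1)) (v (k + 1 + (i : Fin (n + 1)))) := by
    intro i
    induction i with
    | zero =>
      intro _
      rw [Nat.cast_zero, add_zero]
    | succ i ih =>
      intro hi
      refine (ih (by omega)).tail ⟨f (k + 1 + (i : Fin (n + 1))), fun he => ?_, ?_⟩
      -- Meeting `f k` again would force `n + 1` to divide `i + 1`, although `i + 1 ≤ n`.
      · have h1 := hf he
        rw [add_assoc, add_eq_left, add_comm (1 : Fin (n + 1)), ← Nat.cast_succ, Fin.natCast_eq_zero] at h1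
        exact absurd (Nat.le_of_dvd (by omega) h1) (by omega)
      · rw [Nat.cast_succ, ← add_assoc (k + 1)]
        exact hl _
  have := key n le_rfl
  rwa [add_assoc, add_comm (1 : Fin (n + 1)), ← Nat.cast_succ, Fin.natCast_self, add_zero] at this

/-- Forgetting edge labels and loops yields a simple graph with a path from `y` to `x`. Choosing
labels along it and closing with `e` gives the cycle; a loop comes from the path of length zero. -/
theorem onCycle_of_reflTransGen_adj {e : E} {x y : V} (hl : G.IsLink e x y)
    (h : Relation.ReflTransGen (G.restrict {e}ᶜ).Adj y x) : OnCycle G e := by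
  let H : SimpleGraph V := SimpleGraph.fromRel (G.restrict {e}ᶜ).Adj
  have hreach : H.Reachable y x := by
    clear hl
    induction h with
    | refl => exact SimpleGraph.Reachable.refl _
    | @tail b c _ hbc ih =>
      by_cases hne : b = c
      · exact hne ▸ ih
      · exact ih.trans (SimpleGraph.Adj.reachable ((SimpleGraph.fromRel_adj _ _ _).2
          ⟨hne, Or.inl hbc⟩))
  obtain ⟨w, hw⟩ := hreach.exists_isPath
  have hedge (i : ℕ) : ∃ g, i < w.length →
      g ≠ e ∧ G.IsLink g (w.getVert i) (w.getVert (i + 1)) := by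
    by_cases hi : i < w.length
    · have hadj := ((SimpleGraph.fromRel_adj _ _ _).1 (w.adj_getVert_succ hi)).2
      rcases hadj with ⟨g, hg, hg'⟩ | ⟨g, hg, hg'⟩
      · exact ⟨g, fun _ => ⟨hg, hg'⟩⟩
      · exact ⟨g, fun _ => ⟨hg, hg'.symm⟩⟩
    · exact ⟨e, fun h => absurd h hi⟩
  choose g hg using hedge
  have hinj {i j : ℕ} (hi : i ≤ w.length) (hj : j ≤ w.length)
      (hij : w.getVert i = w.getVert j) : i = j := hw.getVert_injOn hi hj hij
  -- A repeated edge would identify vertex `i` of the path with vertex `j` or `j + 1`, both later.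
  have hlt {i j : ℕ} (hij : i < j) (hj : j < w.length) : g i ≠ g j := by
    intro he
    have h1 := (hg i (by omega)).2
    rw [he] at h1
    rcases h1.left_eq_or_eq (hg j hj).2 with h2 | h2
    · exact absurd (hinj (by omega) (by omega) h2) (by omega)
    · exact absurd (hinj (by omega) (by omega) h2) (by omega)
  refine ⟨w.length, fun k => w.getVert k, fun k => if (k : ℕ) < w.length then g k else e,
    fun i j hij => Fin.ext (hinj (by omega) (by omega) hij), ?_, ?_, Fin.last _, ?_⟩
  · intro i j hij
    have hi := i.isLt
    have hj := j.isLt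
    simp only at hij
    apply Fin.ext
    split_ifs at hij with h1 h2 h2
    · rcases lt_trichotomy (i : ℕ) j with h3 | h3 | h3
      · exact absurd hij (hlt h3 h2)
      · exact h3
      · exact absurd hij.symm (hlt h3 h1)
    · exact absurd hij (hg i h1).1
    · exact absurd hij.symm (hg j h2).1
    · omega
  · intro k
    simp only
    split_ifs with hk
    · rw [Fin.val_add_one_of_lt (by simpa [Fin.lt_def] using hk)]
      exact (hg k hk).2
    -- At the last index `k + 1` wraps around to 0, so `e` closes the path.
    · obtain rfl : k = Fin.last _ := Fin.ext (by have := k.isLt; simp only [Fin.val_last]; omega)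
      simpa using hl
  · simp

end Multigraph

/-! ### The adequacy criterion -/

theorem theorem1p1 {C : Type*} [Finite C] [Nonempty C] (D : LinkDiagram C)
    (hconn : D.IsConnected) (hred : D.IsReduced) (χ : D.Checkerboard) (σ : C → Resolution) :
    D.IsAdequate σ ↔
      (∀ e ∈ χ.stateEdges σ,
        Multigraph.OnCycle (χ.taitGraph.restrict (χ.stateEdges σ)) e) ∧
      (∀ e ∈ χ.taitGraph.edgeSet \ χ.stateEdges σ, ∀ x y, χ.taitGraph.IsLink e x y →
        ¬ Multigraph.SameComponent (χ.taitGraph.restrict (χ.stateEdges σ)) x y) := by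
  set S := χ.stateEdges σ with hS
  have hg := χ.doubleGenus_univ_le hconn
  have hin (e : C) (he : e ∈ S) :
      ¬ (RibbonGraph.boundary χ.blackNext S).SameCycle (e, false) (e, true) ↔
        Multigraph.OnCycle (χ.taitGraph.restrict S) e := by
    -- Planarity speaks about edges outside the set, so `e` is removed and the toggling under
    -- reinsertion is used.
    have hn : e ∉ S \ {e} := fun h => h.2 rfl
    have h1 := RibbonGraph.sameCycle_boundary_insert χ.blackNext hn
    rw [Set.insert_sdiff_singleton, Set.insert_eq_of_mem he] at h1
    have hr : (χ.taitGraph.restrict S).restrict {e}ᶜ = χ.taitGraph.restrict (S \ {e}) := by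
      rw [Graph.restrict_restrict, Set.sdiff_eq]
    rw [h1, not_not, RibbonGraph.sameCycle_iff_component _ hg hn]
    constructor
    · intro h
      refine Multigraph.onCycle_of_reflTransGen_adj (x := χ.vertex (e, true))
        (y := χ.vertex (e, false)) ⟨he, (χ.taitGraph_isLink_iff _ _ _).2 ⟨true, rfl, rfl⟩⟩ ?_
      rw [hr]
      exact (χ.component_iff_reflTransGen _ _ _).1 h
    · intro h
      obtain ⟨x, y, ⟨-, hl⟩, h⟩ := Multigraph.reflTransGen_adj_of_onCycle h
      rw [hr] at h
      obtain ⟨β, rfl, rfl⟩ := (χ.taitGraph_isLink_iff _ _ _).1 hl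
      have h' := (χ.component_iff_reflTransGen _ _ _).2 h
      cases β
      · exact Setoid.symm' _ h'
      · exact h'
  have hout (e : C) (he : e ∉ S) :
      ¬ (RibbonGraph.boundary χ.blackNext S).SameCycle (e, false) (e, true) ↔
        ∀ x y, χ.taitGraph.IsLink e x y →
          ¬ Multigraph.SameComponent (χ.taitGraph.restrict S) x y := by
    rw [RibbonGraph.sameCycle_iff_component _ hg he]
    constructor
    · rintro hc x y hl ⟨-, h⟩
      obtain ⟨β, rfl, rfl⟩ := (χ.taitGraph_isLink_iff _ _ _).1 hl
      have h' := (χ.component_iff_reflTransGen _ _ _).2 h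
      cases β
      · exact hc h'
      · exact hc (Setoid.symm' _ h')
    · intro hc h
      exact hc _ _ ((χ.taitGraph_isLink_iff _ _ _).2 ⟨false, rfl, rfl⟩)
        ⟨χ.isBlack_corner (e, false), (χ.component_iff_reflTransGen _ _ _).1 h⟩
  rw [χ.isAdequate_iff]
  constructor
  · exact fun h => ⟨fun e he => (hin e he).1 (h e), fun e he => (hout e he.2).1 (h e)⟩
  · rintro ⟨h1, h2⟩ e
    by_cases he : e ∈ S
    · exact (hin e he).2 (h1 e he)
    · exact (hout e he).2 (h2 e ⟨Set.mem_univ e, he⟩)
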